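/- Let $r\in\mathbb N_0$, let $D\subset\mathbb R$ be open, and let $f:D\to\mathbb R$ be $(r+1)$-times continuously differentiable. Put $$F(w,y)=\sum_{j=0}^{r}\frac{f^{(j)}(y)}{j!}\,w^j,\qquad (w,y)\in\mathbb R\times D.$$ For $y\in D$ let $h\mapsto w(h,y)$ be the maximally extended solution (forward and backward in $h$) of $$\frac{\partial w}{\partial h}(h,y)=F(w(h,y),y),\qquad w(0,y)=0,$$ let $U_{\max}\subset\mathbb R\times D$ be the set of all $(h,y)$ with $y \in D$ such that $h$ lies in the maximal interval of existence of $w(\cdot,y)$, and define $\Phi:U_{\max}\to\mathbb R$ by $\Phi(h,y)=y+w(h,y)$. Then: 1. $U_{\max}$ is open in $\mathbb R^2$, and for every $k\in\mathbb N_0$ the partial derivative $\partial_h^k\Phi$ exists and is continuously differentiable with respect to $(h,y)$ on $U_{\max}$. 2. For every compact subset $K\subset D$ there exists $h_0>0$ such that $[0,h_0]\times K\subset U_{\max}$ (that is, $\Phi$ is defined on $[0,h_0]\times K$), and $\frac{\partial\Phi}{\partial h}$ satisfies a Lipschitz condition with respect to $y$ on $[0,h_0]\times K$: there is a constant $L\ge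 0$ such that $$\Bigl|\frac{\partial\Phi}{\partial h}(h,y_1)-\frac{\partial\Phi}{\partial h}(h,y_2)\Bigr|\le L\,|y_1-y_2|\qquad\text{for all } h\in[0,h_0],\ y_1,y_2\in K.$$ -/

import Mathlib

open Set

/-- The field `F(w, y) = ∑_{j=0}^{r} f^{(j)}(y) / j! * w^j`: the `r`-th order Taylor polynomial of `f`
centered at `y`, evaluated at `y + w`. It is only used at points `y` of an open set on which `f` is
of class `C^{r+1}`, where the iterated derivatives are the usual ones. -/
noncomputable def taylorField (r : ℕ) (f : ℝ → ℝ) (w y : ℝ) : ℝ :=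
  ∑ j ∈ Finset.range (r + 1), iteratedDeriv j f y / (j.factorial : ℝ) * w ^ j

/-- `u` solves `u' = F(u, y)`, `u(0) = 0` on the open interval `(a, b)`, which contains `0`. -/
structure IsTaylorSolution (r : ℕ) (f : ℝ → ℝ) (y a b : ℝ) (u : ℝ → ℝ) : Prop where
  left_neg : a < 0
  right_pos : 0 < b
  initial : u 0 = 0
  hasDerivAt : ∀ h ∈ Ioo a b, HasDerivAt u (taylorField r f (u h) y) h

/-- The maximal domain `U_max`: all `(h, y)` with `y ∈ D` such that `h` lies in the maximal interval
of existence for the parameter `y`, that is, in the union of all open intervals around `0` on which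
a solution exists. -/
def taylorUmax (r : ℕ) (f : ℝ → ℝ) (D : Set ℝ) : Set (ℝ × ℝ) :=
  {p | p.2 ∈ D ∧ ∃ (u : ℝ → ℝ) (a b : ℝ), IsTaylorSolution r f p.2 a b u ∧ p.1 ∈ Ioo a b}

open Classical in
/-- The maximally extended solution `w(h, y)`: the value at `h` of any solution for the parameter `y`
whose interval contains `h` (all of them agree, see `taylorW_eq`); the value `0` off the maximal
domain is never used. -/
noncomputable def taylorW (r : ℕ) (f : ℝ → ℝ) (h y : ℝ) : ℝ :=
  if hu : ∃ (u : ℝ → ℝ) (a b : ℝ), IsTaylorSolution r f y a b u ∧ h ∈ Ioo a b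
  then hu.choose h else 0

/-- The method function `Φ(h, y) = y + w(h, y)`. -/
noncomputable def taylorPhi (r : ℕ) (f : ℝ → ℝ) (h y : ℝ) : ℝ :=
  y + taylorW r f h y

/-- The `k`-th partial derivative of `Φ` with respect to `h`, at `(h, y)`. -/
noncomputable def taylorPhiDeriv (r : ℕ) (f : ℝ → ℝ) (k : ℕ) (h y : ℝ) : ℝ :=
  iteratedDeriv k (fun s => taylorPhi r f s y) h

/-- Two solutions for the same parameter agree wherever both are defined. -/
theorem IsTaylorSolution.unique {r : ℕ} {f : ℝ → ℝ} {y a b a' b' : ℝ} {u v : ℝ → ℝ}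
    (hu : IsTaylorSolution r f y a b u) (hv : IsTaylorSolution r f y a' b' v) {h : ℝ}
    (h1 : h ∈ Ioo a b) (h2 : h ∈ Ioo a' b') : u h = v h := by
  -- a compact interval inside both domains that contains `0` and `h`
  obtain ⟨c, hc, hc0⟩ := exists_between
    (show max a a' < min 0 h from max_lt (lt_min hu.left_neg h1.1) (lt_min hv.left_neg h2.1))
  obtain ⟨d, hd0, hd⟩ := exists_between
    (show max 0 h < min b b' from max_lt (lt_min hu.right_pos hv.right_pos) (lt_min h1.2 h2.2))
  rw [max_lt_iff] at hc hd0
  rw [lt_min_iff] at hc0 hd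
  have mu : ∀ t ∈ Icc c d, t ∈ Ioo a b := fun t ht =>
    ⟨hc.1.trans_le ht.1, ht.2.trans_lt hd.1⟩
  have mv : ∀ t ∈ Icc c d, t ∈ Ioo a' b' := fun t ht =>
    ⟨hc.2.trans_le ht.1, ht.2.trans_lt hd.2⟩
  have cu : ContinuousOn u (Icc c d) := fun t ht =>
    (hu.hasDerivAt t (mu t ht)).continuousAt.continuousWithinAt
  have cv : ContinuousOn v (Icc c d) := fun t ht =>
    (hv.hasDerivAt t (mv t ht)).continuousAt.continuousWithinAt
  obtain ⟨M, hM⟩ := (isCompact_Icc.image_of_continuousOn cu).isBounded.subset_closedBall 0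
  obtain ⟨N, hN⟩ := (isCompact_Icc.image_of_continuousOn cv).isBounded.subset_closedBall 0
  have hC : ContDiff ℝ 1 (fun w => taylorField r f w y) := by
    unfold taylorField; fun_prop
  obtain ⟨K, hK⟩ := hC.contDiffOn.exists_lipschitzOnWith (one_ne_zero)
    (convex_closedBall (0 : ℝ) (max M N)) (isCompact_closedBall (0 : ℝ) (max M N))
  refine ODE_solution_unique_of_mem_Icc (v := fun _ w => taylorField r f w y)
    (s := fun _ => Metric.closedBall (0 : ℝ) (max M N)) (K := K) (t₀ := 0) (a := c) (b := d)
    (fun t _ => hK) ⟨hc0.1, hd0.1⟩ cu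
    (fun t ht => hu.hasDerivAt t (mu t (Ioo_subset_Icc_self ht)))
    (fun t ht => Metric.closedBall_subset_closedBall (le_max_left _ _)
      (hM ⟨t, Ioo_subset_Icc_self ht, rfl⟩)) cv
    (fun t ht => hv.hasDerivAt t (mv t (Ioo_subset_Icc_self ht)))
    (fun t ht => Metric.closedBall_subset_closedBall (le_max_right _ _)
      (hN ⟨t, Ioo_subset_Icc_self ht, rfl⟩))
    (hu.initial.trans hv.initial.symm) ⟨hc0.2.le, hd0.2.le⟩

/-- `w(·, y)` agrees with every solution for the parameter `y` on its interval. -/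
theorem taylorW_eq {r : ℕ} {f : ℝ → ℝ} {y a b : ℝ} {u : ℝ → ℝ}
    (hu : IsTaylorSolution r f y a b u) {h : ℝ} (hh : h ∈ Ioo a b) :
    taylorW r f h y = u h := by
  have hex : ∃ (u : ℝ → ℝ) (a b : ℝ), IsTaylorSolution r f y a b u ∧ h ∈ Ioo a b :=
    ⟨u, a, b, hu, hh⟩
  obtain ⟨a', b', h', hh'⟩ := hex.choose_spec
  rw [taylorW, dif_pos hex]
  exact h'.unique hu hh' hh

/-- `w` solves the differential equation on the whole maximal domain. -/
theorem taylorW_hasDerivAt {r : ℕ} {f : ℝ → ℝ} {D : Set ℝ} {h y : ℝ}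
    (hp : (h, y) ∈ taylorUmax r f D) :
    HasDerivAt (fun s => taylorW r f s y) (taylorField r f (taylorW r f h y) y) h := by
  obtain ⟨-, u, a, b, hu, hh⟩ := hp
  rw [taylorW_eq hu hh]
  exact (hu.hasDerivAt h hh).congr_of_eventuallyEq
    (Filter.eventually_of_mem (isOpen_Ioo.mem_nhds hh) fun s hs => taylorW_eq hu hs)

open Filter Topology

/-!
Along a solution curve of an autonomous system `x' = F(x)` with `F` of class `C¹`, the integral
equation `u = x + ∫ F ∘ u` in `C([a, b], E)` has at `u` the linearization `1 - T`, where `T` is a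
Volterra operator. Since `‖Tⁿ‖` decays like `1 / n!`, `1 - T` is invertible on the whole interval,
and the implicit function theorem yields the nearby solutions as a `C¹` function of `x`. The field
`F(w, y)` becomes autonomous when `y` is carried along as a constant component of the state. The
differential equation then expresses `∂_h^k Φ(h, y)` as a polynomial in `w(h, y)` with coefficients
of class `C¹` in `y`.
-/

theorem isUnit_one_sub_of_norm_pow_lt_one {R : Type*} [NormedRing R] [HasSummableGeomSeries R]
    {a : R} {n : ℕ} (h : ‖a ^ n‖ < 1) : IsUnit (1 - a) := by
  have hcomm : Commute (1 - a) (∑ i ∈ Finset.range n, a ^ i) :=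
    (mul_neg_geom_sum a n).trans (geom_sum_mul_neg a n).symm
  have hunit := isUnit_one_sub_of_norm_lt_one h
  rw [← mul_neg_geom_sum] at hunit
  exact (hcomm.isUnit_mul_iff.1 hunit).1

section Superposition

section Topological

variable {K X Y : Type*} [TopologicalSpace K] [TopologicalSpace X] [TopologicalSpace Y] [Zero Y]

/-- The superposition (Nemytskii) operator `u ↦ F ∘ u` on continuous functions; the junk value `0`
is taken where `F ∘ u` is not continuous. -/
noncomputable def superposition (F : X → Y) (u : C(K, X)) : C(K, Y) :=
  ContinuousMap.mkD (F ∘ u) 0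

variable {F : X → Y} {V : Set X}

theorem superposition_apply {u : C(K, X)} (hF : ContinuousOn F V) (hu : MapsTo u univ V) (t : K) :
    superposition F u t = F (u t) :=
  ContinuousMap.mkD_apply_of_continuous
    (hF.comp_continuous u.continuous fun t => hu (mem_univ t))

theorem continuousOn_superposition [LocallyCompactSpace K] (hF : ContinuousOn F V) :
    ContinuousOn (superposition F) {u : C(K, X) | MapsTo u univ V} := by
  rw [continuousOn_iff_continuous_domRestrict]
  refine ContinuousMap.continuous_of_continuous_uncurry _ ?_
  have heval : Continuous fun p : {u : C(K, X) | MapsTo u univ V} × K => p.1.1 p.2 := by fun_prop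
  exact (hF.comp_continuous heval fun p => p.1.2 (mem_univ p.2)).congr fun p =>
    (superposition_apply hF p.1.2 p.2).symm

end Topological

variable {K E G : Type*} [TopologicalSpace K] [CompactSpace K]
  [NormedAddCommGroup E] [NormedSpace ℝ E] [NormedAddCommGroup G] [NormedSpace ℝ G]

/-- The action of a continuous family of operators `A t : E →L[ℝ] G` on continuous functions, as a
bounded bilinear map; `pointwiseApply (superposition (fderiv ℝ F) u)` is the derivative of the
superposition operator of `F` at `u`. -/
noncomputable def pointwiseApply : C(K, E →L[ℝ] G) →L[ℝ] C(K, E) →L[ℝ] C(K, G) :=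
  LinearMap.mkContinuous₂
    (LinearMap.mk₂ ℝ (fun (A : C(K, E →L[ℝ] G)) (u : C(K, E)) =>
        (⟨fun t => A t (u t), by fun_prop⟩ : C(K, G)))
      (fun _ _ _ => rfl) (fun _ _ _ => rfl)
      (fun _ _ _ => by ext; simp) (fun _ _ _ => by ext; simp))
    1 fun A u => by
      refine (ContinuousMap.norm_le _ (by positivity)).2 fun t => ?_
      rw [one_mul]
      exact (A t).le_of_opNorm_le_of_le (A.norm_coe_le_norm t) (u.norm_coe_le_norm t)

theorem pointwiseApply_apply (A : C(K, E →L[ℝ] G)) (u : C(K, E)) (t : K) :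
    pointwiseApply A u t = A t (u t) :=
  rfl

theorem isOpen_setOf_mapsTo_univ {X : Type*} [TopologicalSpace X] {V : Set X} (hV : IsOpen V) :
    IsOpen {u : C(K, X) | MapsTo u univ V} :=
  ContinuousMap.isOpen_setOfPred_mapsTo isCompact_univ hV

variable [LocallyCompactSpace K] {F : E → G} {V : Set E} {u : C(K, E)}

theorem hasFDerivAt_superposition (hV : IsOpen V) (hF : ContDiffOn ℝ 1 F V)
    (hu : MapsTo u univ V) :
    HasFDerivAt (superposition F) (pointwiseApply (superposition (fderiv ℝ F) u)) u := by
  have hF' := hF.continuousOn_fderiv_of_isOpen hV le_rfl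
  have hcont : ContinuousAt (superposition (fderiv ℝ F)) u :=
    (continuousOn_superposition hF').continuousAt ((isOpen_setOf_mapsTo_univ hV).mem_nhds hu)
  refine hasFDerivAt_iff_isLittleO.2 (Asymptotics.isLittleO_iff.2 fun ε hε => ?_)
  obtain ⟨δ, hδ, hball⟩ := Metric.mem_nhds_iff.1 (inter_mem
    ((isOpen_setOf_mapsTo_univ hV).mem_nhds hu)
    (hcont (Metric.closedBall_mem_nhds (superposition (fderiv ℝ F) u) hε)))
  filter_upwards [Metric.ball_mem_nhds u hδ] with v hv
  refine (ContinuousMap.norm_le _ (by positivity)).2 fun t => ?_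
  have hseg : ∀ x ∈ segment ℝ (u t) (v t), ∃ w ∈ Metric.ball u δ, w t = x := by
    rintro x ⟨a, b, ha, hb, hab, rfl⟩
    exact ⟨a • u + b • v, (convex_ball u δ) (Metric.mem_ball_self hδ) hv ha hb hab, rfl⟩
  have hdiff : ∀ x ∈ segment ℝ (u t) (v t), DifferentiableAt ℝ F x := by
    intro x hx
    obtain ⟨w, hw, rfl⟩ := hseg x hx
    exact (hF.differentiableOn one_ne_zero).differentiableAt
      (hV.mem_nhds ((hball hw).1 (mem_univ t)))
  have hbound : ∀ x ∈ segment ℝ (u t) (v t), ‖fderiv ℝ F x - fderiv ℝ F (u t)‖ ≤ ε := by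
    intro x hx
    obtain ⟨w, hw, rfl⟩ := hseg x hx
    rw [← superposition_apply hF' (hball hw).1, ← superposition_apply hF' hu, ← dist_eq_norm]
    exact (ContinuousMap.dist_apply_le_dist t).trans (hball hw).2
  simp only [ContinuousMap.sub_apply, pointwiseApply_apply,
    superposition_apply hF.continuousOn (hball hv).1, superposition_apply hF.continuousOn hu,
    superposition_apply hF' hu]
  refine ((convex_segment _ _).norm_image_sub_le_of_norm_fderiv_le' hdiff hbound
    (left_mem_segment ℝ _ _) (right_mem_segment ℝ _ _)).trans ?_
  gcongr
  exact (v - u).norm_coe_le_norm t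

theorem contDiffAt_superposition (hV : IsOpen V) (hF : ContDiffOn ℝ 1 F V)
    (hu : MapsTo u univ V) : ContDiffAt ℝ 1 (superposition F) u :=
  contDiffAt_one_iff.2 ⟨_, _, (isOpen_setOf_mapsTo_univ hV).mem_nhds hu,
    pointwiseApply.continuous.comp_continuousOn
      (continuousOn_superposition (hF.continuousOn_fderiv_of_isOpen hV le_rfl)),
    fun _ hv => hasFDerivAt_superposition hV hF hv⟩

end Superposition

section Volterra

theorem intervalIntegrable_IccExtend {E : Type*} [NormedAddCommGroup E] {a b : ℝ} (hab : a ≤ b)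
    (u : C(Icc a b, E)) (s t : ℝ) :
    IntervalIntegrable (IccExtend hab u) MeasureTheory.volume s t :=
  u.continuous.Icc_extend'.intervalIntegrable s t

variable {E : Type*} [NormedAddCommGroup E] [NormedSpace ℝ E] {a b : ℝ}

/-- The functional `u ↦ ∫_{t₀}^{t} u`, where `u : C([a, b], E)` is extended to all of `ℝ` by its
values at the endpoints, so that `t` need not lie in `[a, b]`. -/
noncomputable def integralFrom (t₀ : Icc a b) (t : ℝ) : C(Icc a b, E) →L[ℝ] E :=
  LinearMap.mkContinuous
    { toFun := fun u => ∫ τ in t₀..t, IccExtend (t₀.2.1.trans t₀.2.2) u τ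
      map_add' := fun u v => intervalIntegral.integral_add (intervalIntegrable_IccExtend _ u _ _)
        (intervalIntegrable_IccExtend _ v _ _)
      map_smul' := fun c u => intervalIntegral.integral_smul c _ }
    |t - t₀| fun u => by
      rw [mul_comm]
      exact intervalIntegral.norm_integral_le_of_norm_le_const fun τ _ => u.norm_coe_le_norm _

theorem integralFrom_apply (t₀ : Icc a b) (t : ℝ) (u : C(Icc a b, E)) :
    integralFrom t₀ t u = ∫ τ in t₀..t, IccExtend (t₀.2.1.trans t₀.2.2) u τ :=
  rfl

theorem integralFrom_self (t₀ : Icc a b) (u : C(Icc a b, E)) : integralFrom t₀ t₀ u = 0 :=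
  intervalIntegral.integral_same

theorem norm_integralFrom_sub_le (t₀ : Icc a b) (s t : ℝ) :
    ‖integralFrom (E := E) t₀ t - integralFrom t₀ s‖ ≤ |t - s| := by
  refine ContinuousLinearMap.opNorm_le_bound _ (abs_nonneg _) fun u => ?_
  rw [sub_apply, integralFrom_apply, integralFrom_apply,
    intervalIntegral.integral_interval_sub_left (intervalIntegrable_IccExtend _ u _ _)
      (intervalIntegrable_IccExtend _ u _ _), mul_comm]
  exact intervalIntegral.norm_integral_le_of_norm_le_const fun τ _ => u.norm_coe_le_norm _

theorem continuous_integralFrom (t₀ : Icc a b) : Continuous (integralFrom (E := E) t₀) := by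
  have hlip : LipschitzWith 1 (integralFrom (E := E) t₀) :=
    lipschitzWith_iff_norm_sub_le.2 fun t s => by
      simpa using norm_integralFrom_sub_le t₀ s t
  exact hlip.continuous

theorem norm_integralFrom_le_of_norm_le_pow {t₀ t : Icc a b} {u : C(Icc a b, E)} {C : ℝ} {n : ℕ}
    (hC : 0 ≤ C) (hu : ∀ τ : Icc a b, ‖u τ‖ ≤ C * |(τ : ℝ) - t₀| ^ n) :
    ‖integralFrom t₀ t u‖ ≤ C * (|(t : ℝ) - t₀| ^ (n + 1) / (n + 1)) := by
  have hbound : ∀ τ ∈ uIoc (t₀ : ℝ) t,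
      ‖IccExtend (t₀.2.1.trans t₀.2.2) u τ‖ ≤ C * |τ - t₀| ^ n := by
    intro τ hτ
    have hτ' : τ ∈ Icc a b := uIcc_subset_Icc t₀.2 t.2 (uIoc_subset_uIcc hτ)
    rw [IccExtend_of_mem _ _ hτ']
    exact hu ⟨τ, hτ'⟩
  refine (intervalIntegral.norm_integral_le_abs_of_norm_le
    (MeasureTheory.ae_restrict_of_forall_mem measurableSet_uIoc hbound)
    (Continuous.intervalIntegrable (by fun_prop) _ _)).trans_eq ?_
  rw [intervalIntegral.integral_const_mul, abs_mul, abs_of_nonneg hC,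
    intervalIntegral.abs_intervalIntegral_eq, integral_pow_abs_sub_uIoc,
    abs_of_nonneg (by positivity)]

/-- The Volterra operator `u ↦ (t ↦ ∫_{t₀}^{t} u)` on `C([a, b], E)`. -/
noncomputable def volterra (t₀ : Icc a b) : C(Icc a b, E) →L[ℝ] C(Icc a b, E) :=
  LinearMap.mkContinuous
    { toFun := fun u => ⟨fun t => integralFrom t₀ t u, by
        have := continuous_integralFrom (E := E) t₀
        fun_prop⟩
      map_add' := fun u v => by ext; simp
      map_smul' := fun c u => by ext; simp }
    (b - a) fun u => by
      have hab : 0 ≤ b - a := sub_nonneg.2 (t₀.2.1.trans t₀.2.2)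
      refine (ContinuousMap.norm_le _ (by positivity)).2 fun t => ?_
      calc ‖integralFrom t₀ t u‖ ≤ ‖u‖ * (|(t : ℝ) - t₀| ^ (0 + 1) / ((0 : ℕ) + 1)) :=
            norm_integralFrom_le_of_norm_le_pow (norm_nonneg u) fun τ => by
              simpa using u.norm_coe_le_norm τ
        _ = |(t : ℝ) - t₀| * ‖u‖ := by simp [mul_comm]
        _ ≤ (b - a) * ‖u‖ := by
            gcongr
            exact Real.dist_le_of_mem_Icc t.2 t₀.2

theorem volterra_apply (t₀ : Icc a b) (u : C(Icc a b, E)) (t : Icc a b) :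
    volterra t₀ u t = integralFrom t₀ t u :=
  rfl

theorem norm_volterra_comp_pow_apply_le (t₀ : Icc a b) (A : C(Icc a b, E →L[ℝ] E)) (n : ℕ)
    (u : C(Icc a b, E)) (t : Icc a b) :
    ‖((volterra t₀ ∘L pointwiseApply A) ^ n) u t‖ ≤
      ‖A‖ ^ n * ‖u‖ / n.factorial * |(t : ℝ) - t₀| ^ n := by
  induction n generalizing t with
  | zero => simpa using u.norm_coe_le_norm t
  | succ n ih =>
    rw [pow_succ', mul_apply_eq_comp, ContinuousLinearMap.comp_apply, volterra_apply]
    have hbound (τ : Icc a b) :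
        ‖pointwiseApply A (((volterra t₀ ∘L pointwiseApply A) ^ n) u) τ‖ ≤
          ‖A‖ * (‖A‖ ^ n * ‖u‖ / n.factorial) * |(τ : ℝ) - t₀| ^ n := by
      rw [pointwiseApply_apply, mul_assoc]
      exact (A τ).le_of_opNorm_le_of_le (A.norm_coe_le_norm τ) (ih τ)
    refine (norm_integralFrom_le_of_norm_le_pow (by positivity) hbound).trans_eq ?_
    rw [Nat.factorial_succ]
    push_cast
    field_simp
    ring

variable [CompleteSpace E]

theorem hasDerivAt_integralFrom (t₀ : Icc a b) (u : C(Icc a b, E)) (t : ℝ) :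
    HasDerivAt (fun s => integralFrom t₀ s u) (IccExtend (t₀.2.1.trans t₀.2.2) u t) t :=
  (u.continuous.Icc_extend'.integral_hasStrictDerivAt _ _).hasDerivAt

theorem contDiff_integralFrom (t₀ : Icc a b) :
    ContDiff ℝ 1 fun p : ℝ × C(Icc a b, E) => integralFrom t₀ p.1 p.2 := by
  let f₁ : ℝ → C(Icc a b, E) → ℝ →L[ℝ] E := fun t u =>
    ContinuousLinearMap.toSpanSingletonCLE (IccExtend (t₀.2.1.trans t₀.2.2) u t)
  let f₂ : ℝ → C(Icc a b, E) → C(Icc a b, E) →L[ℝ] E := fun t _ => integralFrom t₀ t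
  have cf₁ : Continuous ↿f₁ := by
    refine (ContinuousLinearEquiv.continuous _).comp ?_
    have : Continuous fun p : ℝ × C(Icc a b, E) => p.2 (projIcc a b (t₀.2.1.trans t₀.2.2) p.1) := by
      fun_prop
    exact this
  have cf₂ : Continuous ↿f₂ := (continuous_integralFrom t₀).comp continuous_fst
  refine contDiff_one_iff_hasFDerivAt.2 ⟨fun p => (↿f₁ p).coprod (↿f₂ p), ?_, fun p => ?_⟩
  · exact (ContinuousLinearMap.coprodEquivL (S := ℝ)).continuous.comp (cf₁.prodMk cf₂)
  · exact (hasStrictFDerivAt_uncurry_coprod (f := fun t u => integralFrom t₀ t u)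
      (.of_forall fun p => (hasDerivAt_integralFrom t₀ p.2 p.1).hasFDerivAt)
      (.of_forall fun p => (integralFrom (E := E) t₀ p.1).hasFDerivAt)
      cf₁.continuousAt cf₂.continuousAt).hasFDerivAt

theorem isUnit_one_sub_volterra_comp (t₀ : Icc a b) (A : C(Icc a b, E →L[ℝ] E)) :
    IsUnit (1 - volterra t₀ ∘L pointwiseApply A) := by
  have hab : 0 ≤ b - a := sub_nonneg.2 (t₀.2.1.trans t₀.2.2)
  obtain ⟨n, hn⟩ := ((FloorSemiring.tendsto_pow_div_factorial_atTop
    (‖A‖ * (b - a))).eventually_lt_const one_pos).exists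
  refine isUnit_one_sub_of_norm_pow_lt_one
    (a := volterra t₀ ∘L pointwiseApply A) (n := n) (lt_of_le_of_lt ?_ hn)
  refine ContinuousLinearMap.opNorm_le_bound _ (by positivity) fun u =>
    (ContinuousMap.norm_le _ (by positivity)).2 fun t => ?_
  calc _ ≤ ‖A‖ ^ n * ‖u‖ / n.factorial * |(t : ℝ) - t₀| ^ n :=
        norm_volterra_comp_pow_apply_le t₀ A n u t
    _ ≤ ‖A‖ ^ n * ‖u‖ / n.factorial * (b - a) ^ n := by
        gcongr
        exact Real.dist_le_of_mem_Icc t.2 t₀.2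
    _ = (‖A‖ * (b - a)) ^ n / n.factorial * ‖u‖ := by rw [mul_pow]; ring

end Volterra

section Flow

variable {E : Type*} [NormedAddCommGroup E] [NormedSpace ℝ E] [CompleteSpace E] {a b : ℝ}
  {t₀ : Icc a b} {F : E → E} {V : Set E}

theorem eq_const_add_volterra_of_isIntegralCurveOn {γ : ℝ → E} {u : C(Icc a b, E)}
    (hF : ContinuousOn F V) (hu : MapsTo u univ V) (huγ : ∀ t : Icc a b, u t = γ t)
    (hγ : IsIntegralCurveOn γ (fun _ => F) (Icc a b)) :
    u = ContinuousMap.const _ (γ t₀) + volterra t₀ (superposition F u) := by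
  ext t
  have hderiv : ∀ τ ∈ Ioo (min (t₀ : ℝ) t) (max (t₀ : ℝ) t), HasDerivWithinAt γ
      (IccExtend (t₀.2.1.trans t₀.2.2) (superposition F u) τ) (Ioi τ) τ := by
    intro τ hτ
    have hτ' : τ ∈ Ioo a b :=
      ⟨(le_min t₀.2.1 t.2.1).trans_lt hτ.1, hτ.2.trans_le (max_le t₀.2.2 t.2.2)⟩
    rw [IccExtend_of_mem _ _ (Ioo_subset_Icc_self hτ'), superposition_apply hF hu, huγ]
    exact ((hγ τ (Ioo_subset_Icc_self hτ')).hasDerivAt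
      (Icc_mem_nhds hτ'.1 hτ'.2)).hasDerivWithinAt
  rw [ContinuousMap.add_apply, ContinuousMap.const_apply, volterra_apply, integralFrom_apply,
    intervalIntegral.integral_eq_sub_of_hasDeriv_right
      (hγ.continuousOn.mono (uIcc_subset_Icc t₀.2 t.2)) hderiv
      (intervalIntegrable_IccExtend _ _ _ _), huγ, add_sub_cancel]

theorem isIntegralCurveOn_add_integralFrom {x : E} {u : C(Icc a b, E)}
    (hF : ContinuousOn F V) (hu : MapsTo u univ V)
    (hux : u = ContinuousMap.const _ x + volterra t₀ (superposition F u)) :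
    MapsTo (fun t => x + integralFrom t₀ t (superposition F u)) (Icc a b) V ∧
      IsIntegralCurveOn (fun t => x + integralFrom t₀ t (superposition F u)) (fun _ => F)
        (Icc a b) := by
  have heq (t : ℝ) (ht : t ∈ Icc a b) :
      x + integralFrom t₀ t (superposition F u) = u ⟨t, ht⟩ :=
    (DFunLike.congr_fun hux ⟨t, ht⟩).symm
  refine ⟨fun t ht => ?_, fun t ht => ?_⟩ <;> beta_reduce <;> rw [heq t ht]
  · exact hu (mem_univ _)
  · rw [← superposition_apply hF hu,
      ← IccExtend_of_mem (t₀.2.1.trans t₀.2.2) (superposition F u) ht]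
    exact ((hasDerivAt_integralFrom t₀ _ t).const_add x).hasDerivWithinAt

theorem exists_contDiffAt_eq_const_add_volterra {x₀ : E} {u₀ : C(Icc a b, E)} (hV : IsOpen V)
    (hF : ContDiffOn ℝ 1 F V) (hu₀ : MapsTo u₀ univ V)
    (h : u₀ = ContinuousMap.const _ x₀ + volterra t₀ (superposition F u₀)) :
    ∃ φ : E → C(Icc a b, E), ContDiffAt ℝ 1 φ x₀ ∧ φ x₀ = u₀ ∧
      ∀ᶠ x in 𝓝 x₀, φ x = ContinuousMap.const _ x + volterra t₀ (superposition F (φ x)) := by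
  let Ψ (p : E × C(Icc a b, E)) : C(Icc a b, E) :=
    p.2 - (ContinuousLinearMap.const ℝ (Icc a b) p.1 + volterra t₀ (superposition F p.2))
  have hΨ₀ : Ψ (x₀, u₀) = 0 := sub_eq_zero.2 h
  have hΨ : ContDiffAt ℝ 1 Ψ (x₀, u₀) :=
    contDiffAt_snd.sub (((ContinuousLinearMap.contDiff _).contDiffAt.comp _ contDiffAt_fst).add
      ((volterra t₀).contDiff.contDiffAt.comp _
        ((contDiffAt_superposition hV hF hu₀).comp (x₀, u₀) contDiffAt_snd)))
  have hderiv : fderiv ℝ Ψ (x₀, u₀) ∘L .inr ℝ E C(Icc a b, E) =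
      1 - volterra t₀ ∘L pointwiseApply (superposition (fderiv ℝ F) u₀) := by
    have h₁ := (hΨ.differentiableAt one_ne_zero).hasFDerivAt.comp u₀
      (hasFDerivAt_prodMk_right x₀ u₀)
    have h₂ := (hasFDerivAt_id u₀).sub (((volterra t₀).hasFDerivAt.comp u₀
      (hasFDerivAt_superposition hV hF hu₀)).const_add (ContinuousLinearMap.const ℝ (Icc a b) x₀))
    exact h₁.unique h₂
  have hinv : (fderiv ℝ Ψ (x₀, u₀) ∘L .inr ℝ E C(Icc a b, E)).IsInvertible := by
    obtain ⟨e, he⟩ := isUnit_one_sub_volterra_comp t₀ (superposition (fderiv ℝ F) u₀)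
    exact ⟨ContinuousLinearEquiv.unitsEquiv ℝ _ e, he.trans hderiv.symm⟩
  refine ⟨hΨ.implicitFunction one_ne_zero hinv, hΨ.contDiffAt_implicitFunction one_ne_zero hinv,
    hΨ.implicitFunction_apply_self one_ne_zero hinv, ?_⟩
  filter_upwards [hΨ.eventually_apply_implicitFunction one_ne_zero hinv] with x hx
  exact sub_eq_zero.1 (hx.trans hΨ₀)

theorem exists_contDiffAt_flow_of_isIntegralCurveOn {γ : ℝ → E} (hV : IsOpen V)
    (hF : ContDiffOn ℝ 1 F V) (hγ : IsIntegralCurveOn γ (fun _ => F) (Icc a b))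
    (hγV : MapsTo γ (Icc a b) V) (t₀ : Icc a b) :
    ∃ Φ : ℝ → E → E, (∀ t, ContDiffAt ℝ 1 ↿Φ (t, γ t₀)) ∧
      ∀ᶠ x in 𝓝 (γ t₀), Φ t₀ x = x ∧ MapsTo (Φ · x) (Icc a b) V ∧
        IsIntegralCurveOn (Φ · x) (fun _ => F) (Icc a b) := by
  let u₀ : C(Icc a b, E) := ⟨_, hγ.continuousOn.domRestrict⟩
  have hu₀ : MapsTo u₀ univ V := fun t _ => hγV t.2
  obtain ⟨φ, hφ, hφ₀, heq⟩ := exists_contDiffAt_eq_const_add_volterra hV hF hu₀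
    (eq_const_add_volterra_of_isIntegralCurveOn (t₀ := t₀) hF.continuousOn hu₀ (fun _ => rfl) hγ)
  have hφV : ∀ᶠ x in 𝓝 (γ t₀), MapsTo (φ x) univ V :=
    hφ.continuousAt.eventually_mem
      ((isOpen_setOf_mapsTo_univ hV).mem_nhds (by rwa [mem_ofPred, hφ₀]))
  refine ⟨fun t x => x + integralFrom t₀ t (superposition F (φ x)), fun t => ?_, ?_⟩
  · have hsup : ContDiffAt ℝ 1 (superposition F ∘ φ) (γ t₀) :=
      (contDiffAt_superposition hV hF (by rwa [hφ₀])).comp (γ t₀) hφ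
    have hpair : ContDiffAt ℝ 1 (fun p : ℝ × E => (p.1, superposition F (φ p.2))) (t, γ t₀) :=
      contDiffAt_fst.prodMk (hsup.comp (t, γ t₀) contDiffAt_snd)
    exact contDiffAt_snd.add
      ((contDiff_integralFrom t₀).contDiffAt.comp (t, γ t₀) hpair)
  · filter_upwards [heq, hφV] with x hx hxV
    have hcurve := isIntegralCurveOn_add_integralFrom hF.continuousOn hxV hx
    exact ⟨by rw [integralFrom_self, add_zero], hcurve⟩

end Flow

section PolynomialCoefficients

open Polynomial

variable {𝕜 E : Type*} [NontriviallyNormedField 𝕜] [NormedAddCommGroup E] [NormedSpace 𝕜 E]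

variable (𝕜) in
/-- The ring of functions of class `C^n` on `s`, the coefficients of polynomials depending `C^n`-ly
on a parameter in `s`. -/
def contDiffOnSubring (n : WithTop ℕ∞) (s : Set E) : Subring (E → 𝕜) where
  carrier := {g | ContDiffOn 𝕜 n g s}
  mul_mem' := ContDiffOn.mul
  one_mem' := contDiffOn_const
  add_mem' := ContDiffOn.add
  zero_mem' := contDiffOn_const
  neg_mem' := ContDiffOn.neg

/-- Evaluation of coefficients at the parameter `y`. -/
def contDiffOnSubring.evalHom {n : WithTop ℕ∞} {s : Set E} (y : E) :
    contDiffOnSubring 𝕜 n s →+* 𝕜 :=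
  (Pi.evalRingHom (fun _ => 𝕜) y).comp (contDiffOnSubring 𝕜 n s).subtype

theorem contDiffOnSubring.evalHom_apply {n : WithTop ℕ∞} {s : Set E} (y : E)
    (g : contDiffOnSubring 𝕜 n s) : evalHom y g = (g : E → 𝕜) y :=
  rfl

theorem contDiffOn_eval_map_evalHom {n : WithTop ℕ∞} {s : Set E}
    (p : (contDiffOnSubring 𝕜 n s)[X]) :
    ContDiffOn 𝕜 n (fun q : 𝕜 × E => (p.map (contDiffOnSubring.evalHom q.2)).eval q.1)
      (univ ×ˢ s) := by
  simp only [eval_map, eval₂_eq_sum_range, contDiffOnSubring.evalHom_apply]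
  exact ContDiffOn.sum fun i _ =>
    ((p.coeff i).2.comp contDiffOn_snd fun q hq => hq.2).mul (contDiffOn_fst.pow i)

end PolynomialCoefficients

theorem contDiffOn_iteratedDeriv {𝕜 G : Type*} [NontriviallyNormedField 𝕜] [NormedAddCommGroup G]
    [NormedSpace 𝕜 G] {f : 𝕜 → G} {D : Set 𝕜} (hD : IsOpen D) {m n : ℕ} {j : ℕ}
    (hf : ContDiffOn 𝕜 n f D) (hmj : m + j ≤ n) : ContDiffOn 𝕜 m (iteratedDeriv j f) D := by
  induction j generalizing m with
  | zero => simpa only [iteratedDeriv_zero] using hf.of_le (mod_cast hmj)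
  | succ j ih =>
    rw [iteratedDeriv_succ]
    exact (ih (m := m + 1) (by lia)).deriv_of_isOpen hD (by norm_cast)

theorem exists_lipschitzOnWith_of_contDiffOn_of_isCompact {E G : Type*} [NormedAddCommGroup E]
    [NormedSpace ℝ E] [NormedAddCommGroup G] [NormedSpace ℝ G] {g : E → G} {U S : Set E}
    (hU : IsOpen U) (hg : ContDiffOn ℝ 1 g U) (hS : IsCompact S) (hSU : S ⊆ U) :
    ∃ L, LipschitzOnWith L g S := by
  refine LocallyLipschitzOn.exists_lipschitzOnWith_of_compact hS fun x hx => ?_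
  obtain ⟨L, t, ht, hL⟩ := (hg.contDiffAt (hU.mem_nhds (hSU hx))).exists_lipschitzOnWith
  exact ⟨L, t, mem_nhdsWithin_of_mem_nhds ht, hL⟩

section Taylor

open Polynomial contDiffOnSubring

variable {r : ℕ} {f : ℝ → ℝ} {D : Set ℝ}

theorem exists_eval_map_evalHom_eq_taylorField (hD : IsOpen D)
    (hf : ContDiffOn ℝ ((r + 1 : ℕ) : WithTop ℕ∞) f D) :
    ∃ p : (contDiffOnSubring ℝ 1 D)[X],
      ∀ w y, (p.map (evalHom y)).eval w = taylorField r f w y := by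
  have hcoeff (j : Fin (r + 1)) :
      ContDiffOn ℝ 1 (fun y => iteratedDeriv j f y / (j : ℕ).factorial) D :=
    (contDiffOn_iteratedDeriv (m := 1) hD hf (by lia)).div_const _
  refine ⟨∑ j : Fin (r + 1), C ⟨_, hcoeff j⟩ * X ^ (j : ℕ), fun w y => ?_⟩
  simp [taylorField, Finset.sum_range, Polynomial.map_sum, eval_finsetSum, evalHom_apply]

theorem contDiffOn_taylorField (hD : IsOpen D)
    (hf : ContDiffOn ℝ ((r + 1 : ℕ) : WithTop ℕ∞) f D) :
    ContDiffOn ℝ 1 (fun p : ℝ × ℝ => taylorField r f p.1 p.2) (univ ×ˢ D) := by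
  obtain ⟨p, hp⟩ := exists_eval_map_evalHom_eq_taylorField hD hf
  simpa only [hp] using contDiffOn_eval_map_evalHom p

/-- The autonomous system `(w', y') = (F(w, y), 0)`, in which the parameter `y` is a constant
component of the state. -/
noncomputable def taylorSystem (r : ℕ) (f : ℝ → ℝ) (p : ℝ × ℝ) : ℝ × ℝ :=
  (taylorField r f p.1 p.2, 0)

theorem IsTaylorSolution.of_isIntegralCurveOn {γ : ℝ → ℝ × ℝ} {y c d : ℝ} (hc : c < 0) (hd : 0 < d)
    (hγ : IsIntegralCurveOn γ (fun _ => taylorSystem r f) (Icc c d)) (hγ₀ : γ 0 = (0, y)) :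
    IsTaylorSolution r f y c d fun t => (γ t).1 where
  left_neg := hc
  right_pos := hd
  initial := by rw [hγ₀]
  hasDerivAt t ht := by
    have hconst (s : ℝ) (hs : s ∈ Icc c d) : (γ s).2 = y := by
      have h := (convex_Icc c d).norm_image_sub_le_of_norm_hasDerivWithin_le (C := 0)
        (fun s hs => hasFDerivAt_snd.comp_hasDerivWithinAt s (hγ s hs))
        (fun _ _ => norm_zero.le) ⟨hc.le, hd.le⟩ hs
      rw [zero_mul, norm_le_zero_iff, sub_eq_zero] at h
      exact h.trans (congrArg Prod.snd hγ₀)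
    have h : HasDerivAt (fun t => (γ t).1) (taylorField r f (γ t).1 (γ t).2) t :=
      (ContinuousLinearMap.fst ℝ ℝ ℝ).hasFDerivAt.comp_hasDerivAt t
        ((hγ t (Ioo_subset_Icc_self ht)).hasDerivAt (Icc_mem_nhds ht.1 ht.2))
    rwa [hconst t (Ioo_subset_Icc_self ht)] at h

theorem IsTaylorSolution.isIntegralCurveOn {u : ℝ → ℝ} {y a b : ℝ}
    (hu : IsTaylorSolution r f y a b u) :
    IsIntegralCurveOn (fun t => (u t, y)) (fun _ => taylorSystem r f) (Ioo a b) := fun t ht =>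
  ((hu.hasDerivAt t ht).prodMk (hasDerivAt_const t y)).hasDerivWithinAt

theorem IsTaylorSolution.exists_contDiffAt (hD : IsOpen D)
    (hf : ContDiffOn ℝ ((r + 1 : ℕ) : WithTop ℕ∞) f D) {u : ℝ → ℝ} {y₀ a b c d : ℝ}
    (hu : IsTaylorSolution r f y₀ a b u) (hy₀ : y₀ ∈ D) (hac : a < c) (hc : c < 0) (hd : 0 < d)
    (hdb : d < b) :
    ∃ w : ℝ → ℝ → ℝ, (∀ t, ContDiffAt ℝ 1 ↿w (t, y₀)) ∧
      ∀ᶠ y in 𝓝 y₀, IsTaylorSolution r f y c d (w · y) := by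
  obtain ⟨Φ, hΦ, hcurve⟩ := exists_contDiffAt_flow_of_isIntegralCurveOn (isOpen_univ.prod hD)
    ((contDiffOn_taylorField hD hf).prodMk contDiffOn_const)
    (hu.isIntegralCurveOn.mono (Icc_subset_Ioo hac hdb)) (fun _ _ => ⟨mem_univ _, hy₀⟩)
    ⟨0, hc.le, hd.le⟩
  rw [hu.initial] at hΦ hcurve
  refine ⟨fun t y => (Φ t (0, y)).1, fun t => ?_, ?_⟩
  · have hemb : ContDiffAt ℝ 1 (fun p : ℝ × ℝ => (p.1, ((0 : ℝ), p.2))) (t, y₀) := by fun_prop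
    exact ((hΦ t).comp (t, y₀) hemb).fst
  · have hemb : Tendsto (fun y : ℝ => ((0 : ℝ), y)) (𝓝 y₀) (𝓝 (0, y₀)) :=
      (Continuous.prodMk_right 0).tendsto y₀
    filter_upwards [hemb.eventually hcurve] with y hy
    exact .of_isIntegralCurveOn hc hd hy.2.2 hy.1

theorem taylorUmax_mem_nhds_and_contDiffAt_taylorW (hD : IsOpen D)
    (hf : ContDiffOn ℝ ((r + 1 : ℕ) : WithTop ℕ∞) f D) {p : ℝ × ℝ} (hp : p ∈ taylorUmax r f D) :
    taylorUmax r f D ∈ 𝓝 p ∧ ContDiffAt ℝ 1 (fun q : ℝ × ℝ => taylorW r f q.1 q.2) p := by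
  obtain ⟨hy, u, a, b, hu, hh⟩ := hp
  obtain ⟨c, hac, hc⟩ := exists_between (lt_min hu.left_neg hh.1)
  obtain ⟨d, hd, hdb⟩ := exists_between (max_lt hu.right_pos hh.2)
  rw [lt_min_iff] at hc
  rw [max_lt_iff] at hd
  obtain ⟨w, hw, hsol⟩ := hu.exists_contDiffAt hD hf hy hac hc.1 hd.1 hdb
  have hev : ∀ᶠ q : ℝ × ℝ in 𝓝 p,
      q.1 ∈ Ioo c d ∧ q.2 ∈ D ∧ IsTaylorSolution r f q.2 c d (w · q.2) :=
    (continuousAt_fst.eventually_mem (Ioo_mem_nhds hc.2 hd.2)).and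
      (continuousAt_snd.eventually ((hD.eventually_mem hy).and hsol))
  refine ⟨hev.mono fun q hq => ⟨hq.2.1, _, c, d, hq.2.2, hq.1⟩, ?_⟩
  exact (hw p.1).congr_of_eventuallyEq (hev.mono fun q hq => taylorW_eq hq.2.2 hq.1)

theorem isOpen_taylorUmax (hD : IsOpen D) (hf : ContDiffOn ℝ ((r + 1 : ℕ) : WithTop ℕ∞) f D) :
    IsOpen (taylorUmax r f D) :=
  isOpen_iff_mem_nhds.2 fun _ hp => (taylorUmax_mem_nhds_and_contDiffAt_taylorW hD hf hp).1

theorem contDiffOn_taylorW (hD : IsOpen D) (hf : ContDiffOn ℝ ((r + 1 : ℕ) : WithTop ℕ∞) f D) :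
    ContDiffOn ℝ 1 (fun p : ℝ × ℝ => taylorW r f p.1 p.2) (taylorUmax r f D) := fun _ hp =>
  (taylorUmax_mem_nhds_and_contDiffAt_taylorW hD hf hp).2.contDiffWithinAt

theorem exists_eval_map_evalHom_eq_taylorPhiDeriv (hD : IsOpen D)
    (hf : ContDiffOn ℝ ((r + 1 : ℕ) : WithTop ℕ∞) f D) (k : ℕ) :
    ∃ p : (contDiffOnSubring ℝ 1 D)[X], ∀ h y, (h, y) ∈ taylorUmax r f D →
      taylorPhiDeriv r f k h y = (p.map (evalHom y)).eval (taylorW r f h y) := by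
  obtain ⟨q, hq⟩ := exists_eval_map_evalHom_eq_taylorField hD hf
  induction k with
  | zero =>
    refine ⟨C ⟨id, contDiffOn_id⟩ + X, fun h y _ => ?_⟩
    simp [taylorPhiDeriv, taylorPhi, evalHom_apply]
  | succ k ih =>
    obtain ⟨p, hp⟩ := ih
    refine ⟨derivative p * q, fun h y hhy => ?_⟩
    have hmem : ∀ᶠ s in 𝓝 h, (s, y) ∈ taylorUmax r f D :=
      (Continuous.prodMk_left y).continuousAt.eventually_mem
        ((isOpen_taylorUmax hD hf).mem_nhds hhy)
    have heq : (fun s => taylorPhiDeriv r f k s y) =ᶠ[𝓝 h]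
        fun s => (p.map (evalHom y)).eval (taylorW r f s y) := hmem.mono fun s hs => hp s y hs
    calc taylorPhiDeriv r f (k + 1) h y
        = deriv (fun s => taylorPhiDeriv r f k s y) h := by
          rw [taylorPhiDeriv, iteratedDeriv_succ]; rfl
      _ = deriv (fun s => (p.map (evalHom y)).eval (taylorW r f s y)) h :=
          heq.deriv_eq
      _ = (derivative (p.map (evalHom y))).eval (taylorW r f h y) *
            taylorField r f (taylorW r f h y) y :=
          (((p.map (evalHom y)).hasDerivAt _).comp h (taylorW_hasDerivAt hhy)).deriv
      _ = ((derivative p * q).map (evalHom y)).eval (taylorW r f h y) := by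
          rw [Polynomial.map_mul, eval_mul, derivative_map, hq]

theorem contDiffOn_taylorPhiDeriv (hD : IsOpen D)
    (hf : ContDiffOn ℝ ((r + 1 : ℕ) : WithTop ℕ∞) f D) (k : ℕ) :
    ContDiffOn ℝ 1 (fun p : ℝ × ℝ => taylorPhiDeriv r f k p.1 p.2) (taylorUmax r f D) := by
  obtain ⟨p, hp⟩ := exists_eval_map_evalHom_eq_taylorPhiDeriv hD hf k
  exact ((contDiffOn_eval_map_evalHom p).comp ((contDiffOn_taylorW hD hf).prodMk contDiffOn_snd)
    fun q hq => ⟨mem_univ _, hq.1⟩).congr fun q hq => hp q.1 q.2 hq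

theorem exists_isTaylorSolution (r : ℕ) (f : ℝ → ℝ) (y : ℝ) :
    ∃ (u : ℝ → ℝ) (a b : ℝ), IsTaylorSolution r f y a b u := by
  have hsmooth : ContDiff ℝ 1 fun w => taylorField r f w y := by
    unfold taylorField
    fun_prop
  obtain ⟨u, hu₀, ε, hε, hu⟩ := (hsmooth.contDiffAt (x := 0)
    ).exists_forall_mem_closedBall_exists_eq_forall_mem_Ioo_hasDerivAt₀ 0
  rw [zero_sub, zero_add] at hu
  exact ⟨u, -ε, ε, neg_neg_of_pos hε, hε, hu₀, hu⟩

theorem exists_Icc_prod_subset_taylorUmax (hD : IsOpen D)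
    (hf : ContDiffOn ℝ ((r + 1 : ℕ) : WithTop ℕ∞) f D) {K : Set ℝ} (hK : IsCompact K)
    (hKD : K ⊆ D) : ∃ h₀ : ℝ, 0 < h₀ ∧ Icc 0 h₀ ×ˢ K ⊆ taylorUmax r f D := by
  have hzero : ({0} : Set ℝ) ×ˢ K ⊆ taylorUmax r f D := by
    rintro ⟨h, y⟩ ⟨rfl, hy⟩
    obtain ⟨u, a, b, hu⟩ := exists_isTaylorSolution r f y
    exact ⟨hKD hy, u, a, b, hu, hu.left_neg, hu.right_pos⟩
  obtain ⟨S, T, hS, -, h0S, hKT, hST⟩ :=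
    generalized_tube_lemma isCompact_singleton hK (isOpen_taylorUmax hD hf) hzero
  obtain ⟨h₀, hh₀, hsub⟩ :=
    nhdsGE_basis_Icc.mem_iff.1 (mem_nhdsWithin_of_mem_nhds (hS.mem_nhds (h0S rfl)))
  exact ⟨h₀, hh₀, (prod_mono hsub hKT).trans hST⟩

end Taylor

theorem proposition2p1 (r : ℕ) (D : Set ℝ) (hD : IsOpen D) (f : ℝ → ℝ)
    (hf : ContDiffOn ℝ ((r + 1 : ℕ) : WithTop ℕ∞) f D) :
    (IsOpen (taylorUmax r f D) ∧
      ∀ k : ℕ, ContDiffOn ℝ 1 (fun p : ℝ × ℝ => taylorPhiDeriv r f k p.1 p.2)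
        (taylorUmax r f D)) ∧
    ∀ K : Set ℝ, IsCompact K → K ⊆ D →
      ∃ h₀ : ℝ, 0 < h₀ ∧ Icc 0 h₀ ×ˢ K ⊆ taylorUmax r f D ∧
        ∃ L : ℝ, 0 ≤ L ∧ ∀ h ∈ Icc 0 h₀, ∀ y₁ ∈ K, ∀ y₂ ∈ K,
          |taylorPhiDeriv r f 1 h y₁ - taylorPhiDeriv r f 1 h y₂| ≤ L * |y₁ - y₂| := by
  refine ⟨⟨isOpen_taylorUmax hD hf, contDiffOn_taylorPhiDeriv hD hf⟩, fun K hK hKD => ?_⟩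
  obtain ⟨h₀, hh₀, hsub⟩ := exists_Icc_prod_subset_taylorUmax hD hf hK hKD
  obtain ⟨L, hL⟩ := exists_lipschitzOnWith_of_contDiffOn_of_isCompact (isOpen_taylorUmax hD hf)
    (contDiffOn_taylorPhiDeriv hD hf 1) (isCompact_Icc.prod hK) hsub
  refine ⟨h₀, hh₀, hsub, L, L.2, fun h hh y₁ hy₁ y₂ hy₂ => ?_⟩
  simpa [Prod.dist_eq, Real.dist_eq] using hL.dist_le_mul (h, y₁) ⟨hh, hy₁⟩ (h, y₂) ⟨hh, hy₂⟩
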